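/- Let $X$ be a path-connected, locally finite CW complex, $P:\widetilde X\to X$ its universal covering, and let $\pi=\pi_1(X)$ (with base point $P(\tilde x_0)$ for some $\tilde x_0\in\widetilde X$) act on $\widetilde X$ by deck transformations. Then for every integer $n\ge 2$, $$\widetilde{\operatorname{TC}}_n(X)=\operatorname{TC}^*_{\pi,n}(\widetilde X)\in\{1,2,3,\dots\}\cup\{\infty\}.$$ Here the two invariants are defined as follows; a minimum over the empty set is $\infty$. (1) Let $\prod_\pi\widetilde X=\widetilde X^n/\pi$ be the quotient by the diagonal action, let $$E=\Bigl\{(\omega,x_1,\dots,x_n)\;:\;\omega\in\widetilde X^{[0,1]},\ x_j\in\widetilde X,\ \omega\bigl(\tfrac{j-1}{n-1}\bigr)=x_j\ (1\le j\le n)\Bigr\}\Big/\pi$$ (compact-open topology on paths and quotient topology; $E$ is identified with $X^{[0,1]}$ by lifting paths), and let $p:E\to\prod_\pi\widetilde X$, $q:\prod_\pi\widetilde X\to X^n$ be the maps $p[\omega,x_1,\dots,x_n]=[x_1,\dots,x_n]$ and $q[x_1,\dots,x_n]=(Px_1,\dots,Px_n)$. Then $\widetilde{\operatorname{TC}}_n(X)$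 is the least integer $k\ge1$ such that $X^n$ has an open cover $U_1,\dots,U_k$ for which $p$ admits a continuous section over each $q^{-1}(U_i)$. (2) Let $I_n$ be the wedge of $n$ copies $[0,1]_1,\dots,[0,1]_n$ of the unit interval, glued at their points $0$, and let $1_j\in I_n$ be the endpoint $1$ of $[0,1]_j$. For a space $Y$ with an action of a discrete group $G$, $\operatorname{TC}^*_{G,n}(Y)$ is the least integer $k\ge1$ such that $Y^n$ has a cover by $k$ open sets $U_1,\dots,U_k$, each invariant under the product action of $G^n$, such that over each $U_i$ the map $e_n:Y^{I_n}\to Y^n$, $e_n(\alpha)=(\alpha(1_1),\dots,\alpha(1_n))$, has a continuous section $U_i\to Y^{I_n}$ that is equivariant for the diagonal action of $G$. -/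

import Mathlib

open Set Topology unitInterval

/-! ### CW complexes -/

/-- A CW complex structure on the whole space `X` is locally finite if every point of `X` has a
neighbourhood which meets only finitely many closed cells. -/
def IsLocallyFiniteCW (X : Type*) [TopologicalSpace X] [CWComplex (univ : Set X)] : Prop :=
  LocallyFinite fun c : Σ n, RelCWComplex.cell (univ : Set X) n =>
    RelCWComplex.closedCell (C := (univ : Set X)) c.1 c.2

/-- The closed unit ball of `ℝⁿ` is a retract of `ℝⁿ`, hence locally path-connected. -/
theorem locallyPathConnected_closedBall (n : ℕ) :
    LocallyPathConnectedSpace (Metric.closedBall (0 : Fin n → ℝ) 1) := by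
  have hmem : ∀ x : Fin n → ℝ,
      (fun j => max (-1) (min 1 (x j))) ∈ Metric.closedBall (0 : Fin n → ℝ) 1 := by
    intro x
    rw [mem_closedBall_zero_iff, pi_norm_le_iff_of_nonneg zero_le_one]
    intro j
    rw [Real.norm_eq_abs, abs_le]
    exact ⟨le_max_left _ _, max_le (by norm_num) (min_le_left _ _)⟩
  let r : (Fin n → ℝ) → Metric.closedBall (0 : Fin n → ℝ) 1 := fun x => ⟨_, hmem x⟩
  have hr : Continuous r := by
    refine Continuous.subtype_mk (continuous_pi fun j => ?_) _
    fun_prop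
  have hq : IsQuotientMap r := by
    refine IsQuotientMap.of_inverse (f := Subtype.val) continuous_subtype_val hr ?_
    rintro ⟨x, hx⟩
    refine Subtype.ext (funext fun j => ?_)
    rw [mem_closedBall_zero_iff, pi_norm_le_iff_of_nonneg zero_le_one] at hx
    have h := abs_le.1 (Real.norm_eq_abs (x j) ▸ hx j)
    change max (-1) (min 1 (x j)) = x j
    rw [min_eq_right h.2, max_eq_right h.1]
  exact hq.locallyPathConnectedSpace

/-- CW complexes are locally path-connected, being quotients of disjoint unions of balls. -/
instance locallyPathConnectedSpace_of_cwComplex {X : Type*} [TopologicalSpace X] [T2Space X]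
    [CWComplex (univ : Set X)] : LocallyPathConnectedSpace X := by
  let J := Σ n, RelCWComplex.cell (univ : Set X) n
  have hball : ∀ c : J, LocallyPathConnectedSpace (Metric.closedBall (0 : Fin c.1 → ℝ) 1) :=
    fun c => locallyPathConnected_closedBall c.1
  let f : (Σ c : J, Metric.closedBall (0 : Fin c.1 → ℝ) 1) → X :=
    fun y => RelCWComplex.map y.1.1 y.1.2 y.2.1
  have hc : ∀ c : J, Continuous fun z : Metric.closedBall (0 : Fin c.1 → ℝ) 1 => f ⟨c, z⟩ :=
    fun c => (RelCWComplex.continuousOn c.1 c.2).domRestrict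
  have hf : Continuous f := continuous_sigma hc
  have hq : IsQuotientMap f := by
    refine isQuotientMap_iff_isClosed.2 ⟨?_, fun A => ⟨fun h => h.preimage hf, fun h => ?_⟩⟩
    · intro x
      have hx : x ∈ ⋃ (n : ℕ) (j : RelCWComplex.cell (univ : Set X) n),
          RelCWComplex.closedCell (C := (univ : Set X)) n j := by
        rw [CWComplex.union]; trivial
      simp only [mem_iUnion] at hx
      obtain ⟨n, j, z, hz, rfl⟩ := hx
      exact ⟨⟨⟨n, j⟩, ⟨z, hz⟩⟩, rfl⟩
    · refine CWComplex.closed' A (subset_univ _) fun n j => ?_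
      have h1 : IsClosed ((fun z : Metric.closedBall (0 : Fin n → ℝ) 1 =>
          f ⟨⟨n, j⟩, z⟩) ⁻¹' A) := isClosed_sigma_iff.1 h ⟨n, j⟩
      have h2 := (h1.isCompact.image (hc ⟨n, j⟩)).isClosed
      convert h2 using 1
      ext x
      constructor
      · rintro ⟨hx, z, hz, rfl⟩
        exact ⟨⟨z, hz⟩, hx, rfl⟩
      · rintro ⟨⟨z, hz⟩, hx, rfl⟩
        exact ⟨hx, z, hz, rfl⟩
  exact hq.locallyPathConnectedSpace

/-! ### Deck transformations and the action of the fundamental group on the universal cover -/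

section Deck

variable {X E : Type*} [TopologicalSpace X] [TopologicalSpace E]

/-- The deck transformations of `P : E → X`: the self-homeomorphisms of `E` over `X`. -/
def deckGroup (P : E → X) : Subgroup (E ≃ₜ E) where
  carrier := {φ | ∀ e, P (φ e) = P e}
  mul_mem' {φ ψ} hφ hψ e := (hφ (ψ e)).trans (hψ e)
  one_mem' _ := rfl
  inv_mem' {φ} hφ e := by
    have h := hφ (φ.symm e)
    rw [φ.apply_symm_apply] at h
    exact h.symm

instance deckMulAction (P : E → X) : MulAction (deckGroup P) E where
  smul φ e := φ.1 e
  one_smul _ := rfl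
  mul_smul _ _ _ := rfl

theorem IsCoveringMap.surjective_of_pathConnected [PathConnectedSpace X] [Nonempty E] {P : E → X}
    (hP : IsCoveringMap P) : Function.Surjective P := by
  intro x
  obtain ⟨e⟩ := ‹Nonempty E›
  let γ := PathConnectedSpace.somePath (P e) x
  refine ⟨hP.liftPath γ e γ.source 1, ?_⟩
  have h := congrFun (hP.liftPath_lifts γ e γ.source) 1
  exact h.trans γ.target

theorem IsCoveringMap.locallyPathConnected_total [LocallyPathConnectedSpace X] {P : E → X}
    (hP : IsCoveringMap P) : LocallyPathConnectedSpace E := by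
  choose c hc _ using hP.isLocalHomeomorph
  let _ : ChartedSpace X E :=
    { atlas := range c
      chartAt := c
      mem_chart_source := hc
      chart_mem_atlas := mem_range_self }
  exact ChartedSpace.locallyPathConnectedSpace X E

theorem IsCoveringMap.exists_deck [LocallyPathConnectedSpace X] [SimplyConnectedSpace E] {P : E → X}
    (hP : IsCoveringMap P) {e e' : E} (h : P e = P e') : ∃ φ : deckGroup P, φ • e' = e := by
  have := hP.locallyPathConnected_total
  let f : C(E, X) := ⟨P, hP.continuous⟩
  obtain ⟨F, ⟨hF, hF'⟩, -⟩ := hP.existsUnique_continuousMap_lifts f e' e h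
  obtain ⟨G, ⟨hG, hG'⟩, -⟩ := hP.existsUnique_continuousMap_lifts f e e' h.symm
  have hFp : ∀ a, P (F a) = P a := congrFun hF'
  have hGp : ∀ a, P (G a) = P a := congrFun hG'
  have h1 : G ∘ F = id := hP.eq_of_comp_eq (G.continuous.comp F.continuous) continuous_id
    (by ext a; simp [hFp, hGp]) e' (by simp [hF, hG])
  have h2 : F ∘ G = id := hP.eq_of_comp_eq (F.continuous.comp G.continuous) continuous_id
    (by ext a; simp [hFp, hGp]) e (by simp [hF, hG])
  exact ⟨⟨⟨⟨F, G, congrFun h1, congrFun h2⟩, F.continuous, G.continuous⟩, hFp⟩, hF⟩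

theorem IsCoveringMap.isQuotientCoveringMap_deck [PathConnectedSpace X]
    [LocallyPathConnectedSpace X] [SimplyConnectedSpace E] {P : E → X} (hP : IsCoveringMap P) :
    IsQuotientCoveringMap P (deckGroup P) where
  toIsQuotientMap := hP.isQuotientMap hP.surjective_of_pathConnected
  continuous_const_smul φ := φ.1.continuous
  apply_eq_iff_mem_orbit {e e'} := by
    constructor
    · exact fun h => hP.exists_deck h
    · rintro ⟨φ, rfl⟩
      exact φ.2 e'
  disjoint e := by
    obtain ⟨U, hU, he, hinj⟩ := hP.isLocalHomeomorph.isLocallyInjective e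
    refine ⟨U, hU.mem_nhds he, ?_⟩
    rintro φ ⟨_, ⟨y, hy, rfl⟩, hy'⟩
    have hfix : φ.1 y = y := hinj hy' hy (φ.2 y)
    have : (φ.1 : E → E) = id := hP.eq_of_comp_eq φ.1.continuous continuous_id
      (funext φ.2) y hfix
    exact Subtype.ext (Homeomorph.ext (congrFun this))

/-- The fundamental group `π₁(X, x)`, with the usual product `[γ] [δ] = [γ followed by δ]`.
Mathlib's `FundamentalGroup X x` carries the opposite product. -/
abbrev PiOne (X : Type*) [TopologicalSpace X] (x : X) : Type _ := (FundamentalGroup X x)ᵐᵒᵖ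

/-- The action of `π₁(X, P e₀)` on the total space of a universal covering `P : E → X` by deck
transformations: the class of a loop `γ` acts by the unique deck transformation which takes `e₀` to
the endpoint of the lift of `γ` that starts at `e₀`. -/
noncomputable def deckAction [PathConnectedSpace X] [LocallyPathConnectedSpace X]
    [SimplyConnectedSpace E] {P : E → X} (hP : IsCoveringMap P) (e₀ : E) :
    PiOne X (P e₀) →* (E ≃ₜ E) :=
  (deckGroup P).subtype.comp <| MonoidHom.comp (MulEquiv.opOp (deckGroup P)).symm.toMonoidHom <|
    (MulEquiv.op (hP.isQuotientCoveringMap_deck.fundamentalGroupEquiv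
      (⟨e₀, rfl⟩ : P ⁻¹' {P e₀}))).toMonoidHom

theorem apply_deckAction [PathConnectedSpace X] [LocallyPathConnectedSpace X]
    [SimplyConnectedSpace E] {P : E → X} (hP : IsCoveringMap P) (e₀ : E) (γ : PiOne X (P e₀))
    (e : E) : P (deckAction hP e₀ γ e) = P e :=
  Subtype.property (p := fun φ => φ ∈ deckGroup P) _ e

theorem deckAction_basepoint [PathConnectedSpace X] [LocallyPathConnectedSpace X]
    [SimplyConnectedSpace E] {P : E → X} (hP : IsCoveringMap P) (e₀ : E)
    (γ : FundamentalGroup X (P e₀)) :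
    deckAction hP e₀ (MulOpposite.op γ) e₀ = hP.monodromy γ ⟨e₀, rfl⟩ :=
  hP.isQuotientCoveringMap_deck.unop_fundamentalGroupToMulOpposite_smul
    (e := (⟨e₀, rfl⟩ : P ⁻¹' {P e₀}))

end Deck

/-! ### Sectional categories -/

/-- The least integer `k ≥ 1` with the property `Q`, and `∞` if there is none. -/
noncomputable def leastCount (Q : ℕ → Prop) : ℕ∞ :=
  sInf ((fun k : ℕ => (k : ℕ∞)) '' {k | 1 ≤ k ∧ Q k})

/-- For maps `p : A → B` and `q : B → C`, the least `k ≥ 1` such that `C` is covered by `k` open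
sets `U` for which `p` has a continuous section over `q ⁻¹' U`. -/
noncomputable def secatTilde {A B C : Type*} [TopologicalSpace A] [TopologicalSpace B]
    [TopologicalSpace C] (p : A → B) (q : B → C) : ℕ∞ :=
  leastCount fun k => ∃ U : Fin k → Set C, (∀ i, IsOpen (U i)) ∧ (⋃ i, U i) = univ ∧
    ∀ i, ∃ s : C(q ⁻¹' U i, A), ∀ b, p (s b) = b

/-! ### Strongly equivariant topological complexity -/

/-- The wedge of `n` copies of `[0, 1]`, glued at their points `0`. -/
def wedgeSetoid (n : ℕ) : Setoid (Fin n × I) where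
  r a b := a = b ∨ (a.2 = 0 ∧ b.2 = 0)
  iseqv := ⟨fun _ => Or.inl rfl, fun h => h.imp Eq.symm And.symm, by
    rintro a b c (rfl | h) (rfl | h')
    · exact Or.inl rfl
    · exact Or.inr h'
    · exact Or.inr h
    · exact Or.inr ⟨h.1, h'.2⟩⟩

/-- The wedge `I_n` of `n` intervals, with the quotient topology. -/
abbrev WedgeI (n : ℕ) : Type := Quotient (wedgeSetoid n)

/-- The endpoint `1` of the `j`-th interval of `I_n`. -/
def wedgeEnd {n : ℕ} (j : Fin n) : WedgeI n := Quotient.mk (wedgeSetoid n) (j, 1)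

/-- The `n`-th strongly equivariant topological complexity of a space `Y` with an action
`ρ` of the discrete group `G`: the least number of open sets `U` that are invariant under `G ^ n`,
cover `Y ^ n`, and have a continuous section of the evaluation map `Y ^ (I_n) → Y ^ n` at the ends
of the intervals which is equivariant for the diagonal action of `G`. -/
noncomputable def strongTC {G Y : Type*} [Group G] [TopologicalSpace Y] (n : ℕ)
    (ρ : G →* (Y ≃ₜ Y)) : ℕ∞ :=
  leastCount fun k => ∃ U : Fin k → Set (Fin n → Y), (∀ i, IsOpen (U i)) ∧ (⋃ i, U i) = univ ∧
    (∀ i, ∀ g : Fin n → G, ∀ x ∈ U i, (fun j => ρ (g j) (x j)) ∈ U i) ∧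
    ∀ i, ∃ s : C(U i, C(WedgeI n, Y)), (∀ x j, s x (wedgeEnd j) = x.1 j) ∧
      ∀ (g : G) (x y : U i), (∀ j, y.1 j = ρ g (x.1 j)) → ∀ t, s y t = ρ g (s x t)

/-! ### The intermediate invariant -/

section Intermediate

variable {G E X : Type*} [Group G] [TopologicalSpace E] [TopologicalSpace X]

/-- The point `j / (n - 1)` of `[0, 1]`, for `j = 0, …, n - 1`. -/
noncomputable def subdiv (n : ℕ) (j : Fin n) : I :=
  ⟨(j : ℝ) / ((n : ℝ) - 1), by
    have h : ((j : ℕ) : ℝ) + 1 ≤ n := by exact_mod_cast j.2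
    have h0 : (0 : ℝ) ≤ (j : ℕ) := Nat.cast_nonneg _
    exact ⟨div_nonneg h0 (by linarith), div_le_one_of_le₀ (by linarith) (by linarith)⟩⟩

/-- The tuples `(ω, x₁, …, xₙ)` of a path `ω` in `E` and its points at the times `j / (n - 1)`. -/
abbrev PathTuple (n : ℕ) (E : Type*) [TopologicalSpace E] : Type _ :=
  {a : C(I, E) × (Fin n → E) // ∀ j, a.1 (subdiv n j) = a.2 j}

/-- The orbit relation of the diagonal action of `G` on `E ^ n`. -/
def tupleSetoid (n : ℕ) (ρ : G →* (E ≃ₜ E)) : Setoid (Fin n → E) where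
  r x y := ∃ g, ∀ j, y j = ρ g (x j)
  iseqv := ⟨fun _ => ⟨1, by simp⟩, fun {x y} ⟨g, h⟩ => ⟨g⁻¹, fun j => by
      rw [h j, ← Homeomorph.mul_apply, ← map_mul, inv_mul_cancel, map_one, Homeomorph.one_apply]⟩,
    fun {x y z} ⟨g, h⟩ ⟨g', h'⟩ => ⟨g' * g, fun j => by
      rw [h' j, h j, map_mul, Homeomorph.mul_apply]⟩⟩

/-- The orbit relation of the action of `G` on tuples `(ω, x₁, …, xₙ)`. -/
def pathTupleSetoid (n : ℕ) (ρ : G →* (E ≃ₜ E)) : Setoid (PathTuple n E) where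
  r a b := ∃ g, (∀ t, b.1.1 t = ρ g (a.1.1 t)) ∧ ∀ j, b.1.2 j = ρ g (a.1.2 j)
  iseqv := ⟨fun _ => ⟨1, by simp⟩, fun {a b} ⟨g, h, k⟩ => ⟨g⁻¹, fun t => by
      rw [h t, ← Homeomorph.mul_apply, ← map_mul, inv_mul_cancel, map_one, Homeomorph.one_apply],
      fun j => by
      rw [k j, ← Homeomorph.mul_apply, ← map_mul, inv_mul_cancel, map_one, Homeomorph.one_apply]⟩,
    fun {a b c} ⟨g, h, k⟩ ⟨g', h', k'⟩ => ⟨g' * g, fun t => by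
      rw [h' t, h t, map_mul, Homeomorph.mul_apply], fun j => by
      rw [k' j, k j, map_mul, Homeomorph.mul_apply]⟩⟩

/-- `p [ω, x₁, …, xₙ] = [x₁, …, xₙ]`. -/
def evalMap (n : ℕ) (ρ : G →* (E ≃ₜ E)) :
    Quotient (pathTupleSetoid n ρ) → Quotient (tupleSetoid n ρ) :=
  Quotient.map' (fun a => a.1.2) fun _ _ ⟨g, _, k⟩ => ⟨g, k⟩

/-- `q [x₁, …, xₙ] = (P x₁, …, P xₙ)`, for a map `P` that is constant on orbits. -/
def projMap (n : ℕ) (ρ : G →* (E ≃ₜ E)) (P : E → X) (h : ∀ g e, P (ρ g e) = P e) :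
    Quotient (tupleSetoid n ρ) → (Fin n → X) :=
  Quotient.lift (fun x j => P (x j)) fun x y ⟨g, k⟩ => funext fun j => by rw [k j, h]

/-- The invariant `TC̃_n(X)` of a space `X` with universal covering `P : E → X`. -/
noncomputable def tildeTC [PathConnectedSpace X] [LocallyPathConnectedSpace X]
    [SimplyConnectedSpace E] {P : E → X} (n : ℕ) (hP : IsCoveringMap P) (e₀ : E) : ℕ∞ :=
  secatTilde (evalMap n (deckAction hP e₀))
    (projMap n (deckAction hP e₀) P (apply_deckAction hP e₀))

end Intermediate

/-! The two least counts agree because their defining predicates hold for the same `k`. The map `P ^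
n : E ^ n → X ^ n` is an open surjection whose fibres are the orbits of `G ^ n`, so taking preimages
and images matches open sets of `X ^ n` with `G ^ n`-invariant open sets of `E ^ n`.

Over matching sets, a section of `p` is the same as a diagonally equivariant choice of paths in `E`
through the prescribed points. Descending to the quotient is formal
(`exists_section_of_equivariant_paths`). Lifting back (`exists_equivariant_paths_of_section`) uses
that the action is free and properly discontinuous: a class over `[x]` has exactly one
representative lying over `x`, and it varies continuously with `x`.

Finally, paths are traded for maps out of `I_n` by precomposition with maps `I_n → [0, 1]` and `[0,
1] → I_n` that match the marked points. No homotopy between their composites and the identities is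
needed, and precomposition preserves equivariance. -/

/-! ### Maps between the interval and the wedge of intervals -/

/-- The map `I_n → [0, 1]` which takes the `j`-th interval linearly onto `[0, j / (n - 1)]`. -/
noncomputable def wedgeToInterval (n : ℕ) : C(WedgeI n, I) where
  toFun := Quotient.lift (fun a : Fin n × I => a.2 * subdiv n a.1) (by
    rintro a b (rfl | ⟨h, h'⟩)
    · rfl
    · simp only [h, h', zero_mul])
  continuous_toFun := by
    refine Continuous.quotient_lift ?_ _
    have h : Continuous (subdiv n) := continuous_of_discreteTopology
    fun_prop

theorem wedgeToInterval_wedgeEnd {n : ℕ} (j : Fin n) :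
    wedgeToInterval n (wedgeEnd j) = subdiv n j :=
  one_mul (subdiv n j)

/-- There is a path in `I_n` which is at the end of the `j`-th interval at time `j / (n - 1)`. -/
theorem exists_interval_to_wedge {n : ℕ} (hn : 2 ≤ n) :
    ∃ r : C(I, WedgeI n), ∀ j, r (subdiv n j) = wedgeEnd j := by
  have hn' : (0 : ℝ) < n - 1 := by
    have : (2 : ℝ) ≤ n := by exact_mod_cast hn
    linarith
  -- In the rescaled time `u * (n - 1)`, `h j` is a tent of height 1 at `j` which vanishes from
  -- distance 1/2 on. The path runs along the `j`-th interval during `A j`, and passes the wedge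
  -- point at half-integers.
  let h : Fin n → I → I := fun j u => projIcc 0 1 zero_le_one (1 - 2 * |(u : ℝ) * (n - 1) - j|)
  let A : Fin n → Set I := fun j => {u | |(u : ℝ) * (n - 1) - j| ≤ 1 / 2}
  have hA : ∀ j, IsClosed (A j) := fun j => isClosed_le (by fun_prop) continuous_const
  have hcov : ∀ u : I, ∃ j, u ∈ A j := by
    intro u
    have hu : 0 ≤ (u : ℝ) * (n - 1) + 1 / 2 := by have := u.2.1; positivity
    have hu' : (u : ℝ) * (n - 1) ≤ n - 1 := mul_le_of_le_one_left hn'.le u.2.2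
    have h1 := Nat.floor_le hu
    have h2 := Nat.lt_floor_add_one ((u : ℝ) * (n - 1) + 1 / 2)
    -- Rounding to the nearest integer stays below `n`, since `u * (n - 1) + 1 / 2 ≤ n - 1 / 2`.
    have hlt : ⌊(u : ℝ) * (n - 1) + 1 / 2⌋₊ < n := by
      rw [Nat.floor_lt hu]; linarith
    refine ⟨⟨_, hlt⟩, ?_⟩
    change |(u : ℝ) * (n - 1) - (⌊(u : ℝ) * (n - 1) + 1 / 2⌋₊ : ℕ)| ≤ 1 / 2
    rw [abs_le]
    constructor <;> linarith
  choose f hf using hcov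
  have hzero : ∀ {i j : Fin n} {u : I}, i ≠ j → u ∈ A i → u ∈ A j → h i u = 0 := by
    intro i j u hij hi hj
    refine projIcc_of_le_left _ ?_
    have hd : (1 : ℝ) ≤ |(i : ℝ) - j| := by
      have hz : ((i : ℕ) : ℤ) - (j : ℕ) ≠ 0 := fun e => hij (Fin.ext (by omega))
      exact_mod_cast Int.one_le_abs hz
    have ht := abs_sub_le (i : ℝ) ((u : ℝ) * (n - 1)) j
    rw [abs_sub_comm (i : ℝ) ((u : ℝ) * (n - 1))] at ht
    have hj' : |(u : ℝ) * (n - 1) - j| ≤ 1 / 2 := hj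
    linarith
  have hg : ∀ j, ∀ u ∈ A j,
      Quotient.mk (wedgeSetoid n) (f u, h (f u) u) = Quotient.mk (wedgeSetoid n) (j, h j u) := by
    intro j u hu
    by_cases e : f u = j
    · rw [e]
    · exact Quotient.sound (Or.inr ⟨hzero e (hf u) hu, hzero (Ne.symm e) hu (hf u)⟩)
  refine ⟨⟨fun u => Quotient.mk (wedgeSetoid n) (f u, h (f u) u), ?_⟩, ?_⟩
  · refine (locallyFinite_of_finite A).continuous
      (eq_univ_of_forall fun u => mem_iUnion.2 ⟨f u, hf u⟩) hA fun j => ?_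
    refine ContinuousOn.congr (Continuous.continuousOn ?_) (hg j)
    refine continuous_quotient_mk'.comp (continuous_const.prodMk ?_)
    exact continuous_projIcc.comp (by fun_prop)
  · intro j
    have hj : (subdiv n j : ℝ) * (n - 1) - j = 0 := by
      change (j : ℝ) / (n - 1) * (n - 1) - j = 0
      rw [div_mul_cancel₀ _ hn'.ne', sub_self]
    have hmem : subdiv n j ∈ A j := by
      change |(subdiv n j : ℝ) * (n - 1) - j| ≤ 1 / 2
      rw [hj]; norm_num
    refine (hg j _ hmem).trans ?_
    have : h j (subdiv n j) = 1 := projIcc_of_right_le _ (by rw [hj]; norm_num)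
    rw [this]; rfl

/-! ### Sections over invariant sets -/

/-- The projection onto the quotient by an orbit relation is open. -/
theorem isOpenMap_quotientMk_of_orbitRel {α ι : Type*} [TopologicalSpace α] (r : Setoid α)
    (T : ι → α → α) (hT : ∀ i, Continuous (T i)) (h : ∀ a b, r a b ↔ ∃ i, b = T i a) :
    IsOpenMap (Quotient.mk r) := by
  intro W hW
  -- By symmetry of `r` the saturation is a union of preimages, so continuity of each `T i`
  -- suffices.
  have : Quotient.mk r ⁻¹' (Quotient.mk r '' W) = ⋃ i, T i ⁻¹' W := by
    ext b
    simp only [mem_preimage, mem_image, mem_iUnion]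
    constructor
    · rintro ⟨a, ha, hab⟩
      obtain ⟨i, rfl⟩ := (h b a).1 (r.symm (Quotient.exact hab))
      exact ⟨i, ha⟩
    · rintro ⟨i, hi⟩
      exact ⟨_, hi, Quotient.sound (r.symm ((h _ _).2 ⟨i, rfl⟩))⟩
  refine isOpen_coinduced.2 ?_
  change IsOpen (Quotient.mk r ⁻¹' _)
  rw [this]
  exact isOpen_iUnion fun i => hW.preimage (hT i)

section Sections

variable {G E X : Type*} [Group G] [TopologicalSpace E] [TopologicalSpace X]

/-- The translate of a tuple `(ω, x₁, …, xₙ)` by a group element. -/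
def PathTuple.translate {n : ℕ} (ρ : G →* (E ≃ₜ E)) (g : G) (a : PathTuple n E) :
    PathTuple n E :=
  ⟨((⟨ρ g, (ρ g).continuous⟩ : C(E, E)).comp a.1.1, fun j => ρ g (a.1.2 j)),
    fun j => congrArg (ρ g) (a.2 j)⟩

theorem PathTuple.continuous_translate {n : ℕ} (ρ : G →* (E ≃ₜ E)) (g : G) :
    Continuous (PathTuple.translate (n := n) ρ g) := by
  refine Continuous.subtype_mk (Continuous.prodMk ?_ ?_) _
  · exact (ContinuousMap.continuous_postcomp _).comp (continuous_fst.comp continuous_subtype_val)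
  · exact continuous_pi fun j => (ρ g).continuous.comp
      ((continuous_apply j).comp (continuous_snd.comp continuous_subtype_val))

theorem pathTupleSetoid_iff {n : ℕ} (ρ : G →* (E ≃ₜ E)) (a b : PathTuple n E) :
    pathTupleSetoid n ρ a b ↔ ∃ g, b = PathTuple.translate ρ g a :=
  exists_congr fun _ => ⟨fun h => Subtype.ext (Prod.ext (ContinuousMap.ext h.1) (funext h.2)),
    fun h => by subst h; exact ⟨fun _ => rfl, fun _ => rfl⟩⟩

theorem isOpenMap_pathTupleMk (n : ℕ) (ρ : G →* (E ≃ₜ E)) :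
    IsOpenMap (Quotient.mk (pathTupleSetoid n ρ)) :=
  isOpenMap_quotientMk_of_orbitRel _ _ (PathTuple.continuous_translate ρ) (pathTupleSetoid_iff ρ)

/-- Let `ρ` be free on `E` and properly discontinuous. A section of `p` over the image of an
invariant set `V ⊆ E ^ n` gives an equivariant choice of paths through the points of `x ∈ V`. -/
theorem exists_equivariant_paths_of_section {n : ℕ} (hn : 0 < n) {ρ : G →* (E ≃ₜ E)}
    (hfree : ∀ e, ∃ N ∈ 𝓝 e, ∀ g, ∀ y ∈ N, ρ g y ∈ N → ρ g = 1) {V : Set (Fin n → E)}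
    {B : Set (Quotient (tupleSetoid n ρ))} (hV : ∀ x ∈ V, Quotient.mk (tupleSetoid n ρ) x ∈ B)
    (τ : C(B, Quotient (pathTupleSetoid n ρ))) (hτ : ∀ b, evalMap n ρ (τ b) = b) :
    ∃ s : C(V, C(I, E)), (∀ x j, s x (subdiv n j) = x.1 j) ∧
      ∀ (g : G) (x y : V), (∀ j, y.1 j = ρ g (x.1 j)) → ∀ t, s y t = ρ g (s x t) := by
  let j₀ : Fin n := ⟨0, hn⟩
  have hfix : ∀ g e, ρ g e = e → ρ g = 1 := by
    intro g e h
    obtain ⟨N, hN, h1⟩ := hfree e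
    exact h1 g e (mem_of_mem_nhds hN) (by rw [h]; exact mem_of_mem_nhds hN)
  let cls : V → B := fun x => ⟨Quotient.mk _ x.1, hV _ x.2⟩
  have hcls : Continuous cls :=
    (continuous_quotient_mk'.comp continuous_subtype_val).subtype_mk _
  have hex : ∀ x : V, ∃ a : PathTuple n E,
      Quotient.mk (pathTupleSetoid n ρ) a = τ (cls x) ∧ a.1.2 = x.1 := by
    intro x
    obtain ⟨a, ha⟩ := Quotient.exists_rep (τ (cls x))
    have h := hτ (cls x)
    rw [← ha] at h
    obtain ⟨g, hg⟩ : tupleSetoid n ρ a.1.2 x.1 := Quotient.exact h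
    refine ⟨PathTuple.translate ρ g a, ?_, (funext hg).symm⟩
    rw [← ha]
    exact Quotient.sound (Setoid.symm' _ ((pathTupleSetoid_iff ρ _ _).2 ⟨g, rfl⟩))
  choose a ha hax using hex
  -- By freeness, a representative is determined by its class and a single coordinate.
  have huniq : ∀ (x : V) (b : PathTuple n E),
      Quotient.mk (pathTupleSetoid n ρ) b = τ (cls x) → ∀ g, b.1.2 j₀ = ρ g (x.1 j₀) →
        b = PathTuple.translate ρ g (a x) := by
    intro x b hb g hg
    obtain ⟨k, rfl⟩ := (pathTupleSetoid_iff ρ _ _).1 (Quotient.exact ((ha x).trans hb.symm))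
    have hk : ρ k (x.1 j₀) = ρ g (x.1 j₀) := by
      rw [← hg, ← congrFun (hax x) j₀]; rfl
    have : ρ (g⁻¹ * k) = 1 := hfix _ (x.1 j₀) (by
      rw [map_mul, Homeomorph.mul_apply, hk, ← Homeomorph.mul_apply, ← map_mul, inv_mul_cancel,
        map_one, Homeomorph.one_apply])
    have hkg : ρ k = ρ g := by
      rw [map_mul, map_inv] at this
      exact (inv_mul_eq_one.1 this).symm
    simp only [PathTuple.translate, hkg]
  have hcont : Continuous a := by
    refine continuous_iff_continuousAt.2 fun x => ?_
    intro W hW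
    obtain ⟨N, hN, hN1⟩ := hfree (x.1 j₀)
    let ev : PathTuple n E → E := fun b => b.1.2 j₀
    have hev : Continuous ev :=
      (continuous_apply j₀).comp (continuous_snd.comp continuous_subtype_val)
    -- For `y` near `x`, openness of the projection gives a representative `b ∈ W` of the class at
    -- `y` whose `j₀`-th point lies in `N`. As `y j₀` is also in `N`, the translation from `a y` to
    -- `b` is trivial.
    have hW' : W ∩ ev ⁻¹' N ∈ 𝓝 (a x) := by
      refine Filter.inter_mem hW (hev.continuousAt.preimage_mem_nhds ?_)
      change N ∈ 𝓝 ((a x).1.2 j₀)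
      rwa [hax x]
    have h1 := (isOpenMap_pathTupleMk n ρ).image_mem_nhds hW'
    rw [ha x] at h1
    have h2 := (τ.continuous.comp hcls).continuousAt.preimage_mem_nhds h1
    have h3 : Continuous fun y : V => y.1 j₀ := (continuous_apply j₀).comp continuous_subtype_val
    change a ⁻¹' W ∈ 𝓝 x
    filter_upwards [h2, h3.continuousAt.preimage_mem_nhds hN] with y ⟨b, ⟨hbW, hbN⟩, hb⟩ hyN
    obtain ⟨k, hk⟩ := (pathTupleSetoid_iff ρ _ _).1 (Quotient.exact ((ha y).trans hb.symm))
    have hk1 : ρ k = 1 := hN1 k (y.1 j₀) hyN (by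
      have : ρ k (y.1 j₀) = b.1.2 j₀ := by rw [hk, ← congrFun (hax y) j₀]; rfl
      rw [this]; exact hbN)
    have : b = a y := by
      rw [hk]
      simp only [PathTuple.translate, hk1]
      rfl
    change a y ∈ W
    rwa [← this]
  refine ⟨⟨fun x => (a x).1.1, continuous_fst.comp (continuous_subtype_val.comp hcont)⟩, ?_, ?_⟩
  · intro x j
    exact ((a x).2 j).trans (congrFun (hax x) j)
  · intro g x y hxy t
    have hc : cls y = cls x := Subtype.ext (Quotient.sound (Setoid.symm' _ ⟨g, hxy⟩))
    have h := huniq x (a y) ((ha y).trans (by rw [hc])) g (by rw [hax y]; exact hxy j₀)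
    change (a y).1.1 t = _
    rw [h]; rfl

/-- An equivariant choice of paths through the points of `x ∈ V` gives a section of `p` over the
image of `V`. -/
theorem exists_section_of_equivariant_paths {n : ℕ} {ρ : G →* (E ≃ₜ E)} {V : Set (Fin n → E)}
    {B : Set (Quotient (tupleSetoid n ρ))} (hB : IsOpen B)
    (hV : ∀ x, Quotient.mk (tupleSetoid n ρ) x ∈ B → x ∈ V)
    (s : C(V, C(I, E))) (hs : ∀ x j, s x (subdiv n j) = x.1 j)
    (heq : ∀ (g : G) (x y : V), (∀ j, y.1 j = ρ g (x.1 j)) → ∀ t, s y t = ρ g (s x t)) :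
    ∃ τ : C(B, Quotient (pathTupleSetoid n ρ)), ∀ b, evalMap n ρ (τ b) = b := by
  have hq := (isQuotientMap_quotient_mk' (s := tupleSetoid n ρ)).restrictPreimage_isOpen hB
  let incl : (Quotient.mk' (s := tupleSetoid n ρ) ⁻¹' B) → V := fun x => ⟨x.1, hV x.1 x.2⟩
  have hincl : Continuous incl := continuous_subtype_val.subtype_mk _
  let lift : C(Quotient.mk' (s := tupleSetoid n ρ) ⁻¹' B, Quotient (pathTupleSetoid n ρ)) :=
    ⟨fun x => Quotient.mk _ ⟨(s (incl x), x.1), hs (incl x)⟩, by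
      refine continuous_quotient_mk'.comp (Continuous.subtype_mk ?_ _)
      exact (s.continuous.comp hincl).prodMk continuous_subtype_val⟩
  have hlift : ∀ x y, (B.restrictPreimage (Quotient.mk' (s := tupleSetoid n ρ))) x =
      B.restrictPreimage (Quotient.mk' (s := tupleSetoid n ρ)) y → lift x = lift y := by
    intro x y hxy
    obtain ⟨g, hg⟩ : tupleSetoid n ρ x.1 y.1 := Quotient.exact (congrArg Subtype.val hxy)
    exact Quotient.sound ⟨g, heq g (incl x) (incl y) hg, hg⟩
  choose rep hrep using hq.surjective
  refine ⟨⟨fun b => lift (rep b), hq.continuous_iff.2 ?_⟩, ?_⟩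
  · exact lift.continuous.congr fun x => (hlift _ _ (hrep _)).symm
  · exact fun b => congrArg Subtype.val (hrep b)

theorem continuous_projMap (n : ℕ) (ρ : G →* (E ≃ₜ E)) {P : E → X} (hP : Continuous P)
    (h : ∀ g e, P (ρ g e) = P e) : Continuous (projMap n ρ P h) :=
  Continuous.quotient_lift (by fun_prop) _

/-- The two invariants agree for the quotient of a space by a free and properly discontinuous
action. -/
theorem secatTilde_eq_strongTC {n : ℕ} (hn : 2 ≤ n) {ρ : G →* (E ≃ₜ E)}
    (hfree : ∀ e, ∃ N ∈ 𝓝 e, ∀ g, ∀ y ∈ N, ρ g y ∈ N → ρ g = 1)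
    {P : E → X} (hPc : Continuous P) (hPo : IsOpenMap P) (hPs : Function.Surjective P)
    (h : ∀ g e, P (ρ g e) = P e) (hfib : ∀ e e', P e = P e' → ∃ g, ρ g e' = e) :
    secatTilde (evalMap n ρ) (projMap n ρ P h) = strongTC n ρ := by
  have hpiC : Continuous fun (x : Fin n → E) j => P (x j) := by fun_prop
  refine congrArg leastCount (funext fun k => propext ⟨?_, ?_⟩)
  · rintro ⟨U, hUo, hUc, hU⟩
    refine ⟨fun i => (fun (x : Fin n → E) j => P (x j)) ⁻¹' U i,
      fun i => (hUo i).preimage hpiC, ?_, ?_, ?_⟩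
    · rw [← preimage_iUnion, hUc, preimage_univ]
    · intro i g x hx
      have : (fun j => P (ρ (g j) (x j))) = fun j => P (x j) := funext fun j => h _ _
      change (fun j => P (ρ (g j) (x j))) ∈ U i
      rw [this]; exact hx
    · intro i
      obtain ⟨τ, hτ⟩ := hU i
      obtain ⟨s, hs, hs'⟩ := exists_equivariant_paths_of_section (by omega) hfree
        (V := (fun (x : Fin n → E) j => P (x j)) ⁻¹' U i) (fun x hx => hx) τ hτ
      refine ⟨⟨fun x => (s x).comp (wedgeToInterval n),
        (ContinuousMap.continuous_precomp _).comp s.continuous⟩, ?_, ?_⟩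
      · intro x j
        exact (congrArg (s x) (wedgeToInterval_wedgeEnd j)).trans (hs x j)
      · exact fun g x y hxy t => hs' g x y hxy _
  · rintro ⟨V, hVo, hVc, hVi, hV⟩
    obtain ⟨r, hr⟩ := exists_interval_to_wedge hn
    have hpiO : IsOpenMap fun (x : Fin n → E) j => P (x j) :=
      IsOpenMap.piMap (fun _ => hPo) (Filter.Eventually.of_forall fun _ => hPs)
    have hUo : ∀ i, IsOpen ((fun (x : Fin n → E) j => P (x j)) '' V i) := fun i => hpiO _ (hVo i)
    refine ⟨fun i => (fun (x : Fin n → E) j => P (x j)) '' V i, hUo, ?_, ?_⟩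
    · rw [← image_iUnion, hVc, image_univ]
      exact range_eq_univ.2 fun y => ⟨fun j => (hPs (y j)).choose,
        funext fun j => (hPs (y j)).choose_spec⟩
    · intro i
      obtain ⟨s, hs, hs'⟩ := hV i
      refine exists_section_of_equivariant_paths ((hUo i).preimage (continuous_projMap n ρ hPc h))
        (V := V i) ?_ ⟨fun x => (s x).comp r,
          (ContinuousMap.continuous_precomp _).comp s.continuous⟩ ?_ ?_
      · rintro x ⟨y, hy, hyx⟩
        -- Each coordinate needs its own group element, so invariance under all of `G ^ n` is what
        -- makes `V i` saturated for `P ^ n`.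
        choose g hg using fun j => hfib (x j) (y j) (congrFun hyx j).symm
        have := hVi i g y hy
        rwa [funext hg] at this
      · intro x j
        exact (congrArg (s x) (hr j)).trans (hs x j)
      · exact fun g x y hxy t => hs' g x y hxy _

end Sections

theorem theoremB {X : Type*} [TopologicalSpace X] [T2Space X] [PathConnectedSpace X]
    [CWComplex (univ : Set X)] (hX : IsLocallyFiniteCW X)
    {E : Type*} [TopologicalSpace E] [SimplyConnectedSpace E]
    (P : E → X) (hP : IsCoveringMap P) (e₀ : E) (n : ℕ) (hn : 2 ≤ n) :
    tildeTC n hP e₀ = strongTC n (deckAction hP e₀) := by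
  have hne : Nonempty E := ⟨e₀⟩
  refine secatTilde_eq_strongTC hn ?_ hP.continuous hP.isLocalHomeomorph.isOpenMap
    hP.surjective_of_pathConnected _ ?_
  · intro e
    obtain ⟨N, hN, hinj⟩ := hP.isLocalHomeomorph.isLocallyInjective e
    refine ⟨N, hN.mem_nhds hinj.1, fun g y hy hgy => ?_⟩
    -- Where `P` is injective, a deck transformation returning a point to `N` fixes it, hence is the
    -- identity by uniqueness of lifts.
    have hfix : deckAction hP e₀ g y = y := hinj.2 hgy hy (apply_deckAction hP e₀ g y)
    exact Homeomorph.ext (congrFun (hP.eq_of_comp_eq (deckAction hP e₀ g).continuous continuous_id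
      (funext (apply_deckAction hP e₀ g)) y hfix))
  · intro e e' hee
    obtain ⟨φ, hφ⟩ := hP.exists_deck hee
    -- Every deck transformation comes from a loop class, so `π₁` is transitive on the fibres.
    obtain ⟨γ, hγ⟩ := (MulEquiv.op (hP.isQuotientCoveringMap_deck.fundamentalGroupEquiv
      (⟨e₀, rfl⟩ : P ⁻¹' {P e₀}))).surjective ((MulEquiv.opOp (deckGroup P)) φ)
    refine ⟨γ, ?_⟩
    have : deckAction hP e₀ γ = φ.1 := by
      simp only [deckAction, MonoidHom.comp_apply]
      exact congrArg (fun z => ((MulEquiv.opOp (deckGroup P)).symm z).1) hγ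
    rw [this]; exact hφ
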